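/- For a field $F$ and $n\ge 1$ let $A_n$ be the space $M_n(F)$ of all $n\times n$ matrices with the tetrad $\{a,b,c,d\}=abcd+dcba$. For $F=\mathbb{Q}$, let $U(A_2)$ be the universal associative envelope of $A_2$: the quotient of the free unital associative $\mathbb{Q}$-algebra on a basis $B$ of $A_2$ (with $A_2$ identified with the linear span of $B$ in it) by the two-sided ideal generated by all $abcd+dcba-\{a,b,c,d\}$ with $a,b,c,d\in B$. For an extension field $K$ of $\mathbb{Q}$, a representation of $A_2$ over $K$ on a $K$-vector space $V$ is a $\mathbb{Q}$-linear map $\rho\colon A_2\to \mathrm{End}_K(V)$ with $\rho(\{a,b,c,d\})=\rho(a)\rho(b)\rho(c)\rho(d)+\rho(d)\rho(c)\rho(b)\rho(a)$ for all $a,b,c,d\in A_2$; it is irreducible if $V\ne 0$ and $V$ has no invariant $K$-subspaces other than $0$ and $V$; an isomorphism of representations is an invertible intertwining $K$-linear map. Then $\dim_{\mathbb{Q}}U(A_2)=25$. Moreover, for $\mathbb{K}=\mathbb{Q}(\beta)$ with $\beta=1+\sqrt{-3}$, there is an isomorphism of $\mathbb{K}$-algebras $$U(A_2)\otimes_{\mathbb{Q}}\mathbb{K}\;\cong\;\mathbb{K}\oplus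 6\,M_2(\mathbb{K}),$$ that is, with the direct product of $\mathbb{K}$ and six copies of $M_2(\mathbb{K})$. Over $\mathbb{K}$, the system $A_2$ has exactly seven finite dimensional irreducible representations up to isomorphism: the 1-dimensional trivial representation (the zero map on $\mathbb{K}$), the 2-dimensional natural representation (matrices acting on $\mathbb{K}^2$), and another five which are 2-dimensional. -/

import Mathlib

open scoped TensorProduct

universe u v w

/-- The tetrad `{a,b,c,d} = abcd + dcba` in an associative algebra. -/
def tetrad {A : Type*} [Ring A] (a b c d : A) : A :=
  a * b * c * d + d * c * b * a

/-- A special Jordan quadruple system: a subspace of an associative `F`-algebra which is closed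
under the tetrad. -/
structure SpecialJQS (F : Type u) (A : Type v) [Field F] [Ring A] [Algebra F A]
    extends Submodule F A where
  tetrad_mem' : ∀ {a b c d : A}, a ∈ carrier → b ∈ carrier → c ∈ carrier → d ∈ carrier →
    tetrad a b c d ∈ carrier

namespace SpecialJQS

variable {F : Type u} {A : Type v} [Field F] [Ring A] [Algebra F A]

/-- The underlying vector space of a special Jordan quadruple system. -/
abbrev Carrier (J : SpecialJQS F A) : Type v := J.toSubmodule

/-- The quadrilinear operation `{a,b,c,d}` of a special Jordan quadruple system. -/
def quad (J : SpecialJQS F A) (a b c d : J.Carrier) : J.Carrier :=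
  ⟨tetrad (a : A) (b : A) (c : A) (d : A), J.tetrad_mem' a.2 b.2 c.2 d.2⟩

/-- The relations `abcd + dcba = {a,b,c,d}` for `a, b, c, d` in `J`, inside the tensor algebra
`T(J)`, i.e. inside the free unital associative algebra on any basis of `J`. Both sides are
quadrilinear, so it is the same to impose them on a basis of `J` only. -/
inductive EnvRel (J : SpecialJQS F A) :
    TensorAlgebra F J.Carrier → TensorAlgebra F J.Carrier → Prop
  | of (a b c d : J.Carrier) :
      EnvRel J
        (tetrad (TensorAlgebra.ι F a) (TensorAlgebra.ι F b)
          (TensorAlgebra.ι F c) (TensorAlgebra.ι F d))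
        (TensorAlgebra.ι F (J.quad a b c d))

/-- The universal associative envelope `U(J)`: the quotient of the free unital associative algebra
`T(J)` by the two-sided ideal generated by all `abcd + dcba - {a,b,c,d}`. -/
abbrev Env (J : SpecialJQS F A) : Type (max u v) := RingQuot J.EnvRel

/-- A representation of `J` over an extension field `K` of `F` on a `K`-vector space `V`: an
`F`-linear map `ρ : J → End_K(V)` with `ρ({a,b,c,d}) = {ρ(a),ρ(b),ρ(c),ρ(d)}`. The `F`-linearity
`ρ(t • a) = t • ρ(a)` is written as semilinearity along `F → K`. -/
structure Rep (J : SpecialJQS F A) (K : Type*) [Field K] [Algebra F K]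
    (V : Type*) [AddCommGroup V] [Module K V] where
  toFun : J.Carrier →ₛₗ[algebraMap F K] Module.End K V
  map_quad : ∀ a b c d : J.Carrier,
    toFun (J.quad a b c d) = tetrad (toFun a) (toFun b) (toFun c) (toFun d)

namespace Rep

variable {J : SpecialJQS F A} {K : Type*} [Field K] [Algebra F K]

/-- Isomorphism of representations: an invertible intertwining `K`-linear map. -/
def Iso {V W : Type*} [AddCommGroup V] [Module K V] [AddCommGroup W] [Module K W]
    (ρ : J.Rep K V) (σ : J.Rep K W) : Prop :=
  ∃ e : V ≃ₗ[K] W, ∀ (a : J.Carrier) (x : V), e (ρ.toFun a x) = σ.toFun a (e x)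

/-- A representation is irreducible if its space is nonzero and the only invariant subspaces are
zero and the whole space. -/
def IsIrreducible {V : Type*} [AddCommGroup V] [Module K V] (ρ : J.Rep K V) : Prop :=
  Nontrivial V ∧
    ∀ W : Submodule K V, (∀ (a : J.Carrier), ∀ x ∈ W, ρ.toFun a x ∈ W) → W = ⊥ ∨ W = ⊤

/-- The trivial representation, the zero map on the one-dimensional space `K`. -/
def trivial (J : SpecialJQS F A) (K : Type*) [Field K] [Algebra F K] : J.Rep K K where
  toFun := 0
  map_quad _ _ _ _ := by simp [tetrad]

end Rep

end SpecialJQS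

/-- The Jordan quadruple system `A_n` over `F`: all `n × n` matrices over `F`. -/
def systemA (n : ℕ) (F : Type u) [Field F] : SpecialJQS F (Matrix (Fin n) (Fin n) F) where
  toSubmodule := ⊤
  tetrad_mem' := fun _ _ _ _ => Submodule.mem_top

/-- The natural representation of `A_n` over `K`: an `n × n` matrix over `F` acts on `K^n` by
matrix-vector multiplication. -/
noncomputable def systemA.natural (n : ℕ) (F : Type u) [Field F]
    (K : Type w) [Field K] [Algebra F K] : (systemA n F).Rep K (Fin n → K) where
  toFun :=
    { toFun := fun a => Matrix.toLin' (a.1.map (algebraMap F K))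
      map_add' := fun a b => by
        rw [← map_add]
        congr 1
        ext i j
        simp
      map_smul' := fun t a => by
        rw [← map_smul]
        congr 1
        ext i j
        simp }
  map_quad a b c d := by
    simp [SpecialJQS.quad, tetrad, Matrix.map_add, Matrix.map_mul, Matrix.toLin'_mul,
      Module.End.mul_eq_comp, LinearMap.comp_assoc]

/-- The quadratic field `𝕂 = ℚ(β)` with `β = 1 + √-3`, as a subfield of `ℂ`. -/
noncomputable abbrev fieldK : IntermediateField ℚ ℂ :=
  IntermediateField.adjoin ℚ {(1 + (Real.sqrt 3 : ℂ) * Complex.I : ℂ)}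

/-! Upper bound. Let `f` preserve tetrads and put `u = f 1`. Tetrads with several entries equal to 1
force `u ^ 4 = u`, make `u ^ 3` a two-sided identity on the image and make `u` commute with it.
Hence `s = u ^ 2 * f` is a Jordan homomorphism and `f = u * s` (`unit_sq_mul_jordan`). The Jordan
algebra of 2 × 2 matrices is a spin factor, so the images under `s` of `E₁₁`, `E₁₂`, `E₂₁` obey
Clifford type relations, and eight ordered monomials span what they generate. Three powers of `u`
and the element 1 give at most 3 · 8 + 1 = 25 dimensions (`mul_mem_span_envelopeWord`).

Lower bound. The tetrad is invariant under reversal, and scaling by a cube root of unity is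
compatible with it because `w ^ 4 = w`. The natural representation and its transpose, each with
three scalings, together with zero, map the envelope to K ⊕ 6 M₂(K). The image of the system
generates this algebra (`modelSubalgebra_eq_top`), so the map is onto and, by dimension, bijective.

The irreducible representations are then those of a split semisimple algebra, found by its block
idempotents and Schur's lemma. -/

/-! ### Tetrad-preserving maps on a unital associative algebra -/

section TetradMap

variable {F A R : Type*} [Field F] [CharZero F] [Ring A] [Algebra F A] [Ring R] [Algebra F R]
  {f : A →ₗ[F] R} (hf : ∀ a b c d, f (tetrad a b c d) = tetrad (f a) (f b) (f c) (f d))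

include hf

omit [CharZero F] in
theorem unit_cube_comm_aux (a : A) : f 1 ^ 3 * f a + f a * f 1 ^ 3 = f a + f a := by
  have h := hf 1 1 1 a
  simp only [tetrad, one_mul, mul_one, map_add] at h
  rw [h]
  noncomm_ring

theorem unit_pow_four : f 1 ^ 4 = f 1 := by
  have h := unit_cube_comm_aux hf 1
  have h2 : (2 : F) • (f 1 ^ 4 - f 1) = 0 := by
    rw [two_smul]
    linear_combination (norm := noncomm_ring) h
  exact sub_eq_zero.1 ((smul_eq_zero.1 h2).resolve_left two_ne_zero)

/-- Here `e = u ^ 3` is idempotent and `e * t + t * e = 2 * t`. Multiplying by `e` on either side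
gives `e * t = e * t * e = t * e`, so both equal `t`. -/
theorem unit_cube_mul (a : A) : f 1 ^ 3 * f a = f a := by
  have h := unit_cube_comm_aux hf a
  have h4 := unit_pow_four hf
  have h6 : f 1 ^ 3 * f 1 ^ 3 = f 1 ^ 3 := by
    calc f 1 ^ 3 * f 1 ^ 3 = f 1 ^ 4 * f 1 ^ 2 := by noncomm_ring
      _ = f 1 ^ 3 := by rw [h4]; noncomm_ring
  generalize f 1 ^ 3 = e at *
  have h1 : e * f a = e * f a * e := by
    have := congrArg (e * ·) h
    simp only [mul_add, ← mul_assoc, h6] at this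
    exact (add_left_cancel this).symm
  have h2 : f a * e = e * f a * e := by
    have := congrArg (· * e) h
    simp only [add_mul, mul_assoc, h6] at this
    rw [mul_assoc]
    exact (add_right_cancel this).symm
  have h3 : (2 : F) • (e * f a - f a) = 0 := by
    rw [two_smul]
    linear_combination (norm := noncomm_ring) h + h1 - h2
  exact sub_eq_zero.1 ((smul_eq_zero.1 h3).resolve_left two_ne_zero)

theorem mul_unit_cube (a : A) : f a * f 1 ^ 3 = f a := by
  have h := unit_cube_comm_aux hf a
  rw [unit_cube_mul hf] at h
  exact add_left_cancel h

theorem unit_comm (a : A) : Commute (f 1) (f a) := by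
  have h := hf 1 a 1 1
  simp only [tetrad, one_mul, mul_one, map_add] at h
  have hl := unit_cube_mul hf a
  have hr := mul_unit_cube hf a
  have h1 := congrArg (f 1 * ·) h
  have h2 := congrArg (· * f 1) h
  have h3 : (3 : F) • (f 1 * f a - f a * f 1) = 0 := by
    have : (3 : F) = 1 + 1 + 1 := by norm_num
    rw [this, add_smul, add_smul, one_smul]
    generalize f 1 = u at *
    generalize f a = t at *
    -- The relation `2t = u t u² + u² t u` is multiplied by `u` on the left and on the right. The
    -- term `u² t u²` occurs both times and cancels in the difference, leaving `3(ut - tu) = 0`.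
    have e1 : u * (t + t) = u * u * t * u * u + t * u := by
      calc _ = u * u * t * u * u + u ^ 3 * t * u := by rw [h1]; noncomm_ring
        _ = _ := by rw [hl]
    have e2 : (t + t) * u = u * t + u * u * t * u * u := by
      calc _ = u * (t * u ^ 3) + u * u * t * u * u := by rw [h2]; noncomm_ring
        _ = _ := by rw [hr]
    linear_combination (norm := noncomm_ring) e1 - e2
  exact sub_eq_zero.1 ((smul_eq_zero.1 h3).resolve_left three_ne_zero)

/-- After division by the central unit a tetrad-preserving map becomes a Jordan homomorphism. -/
theorem unit_sq_mul_jordan (a b : A) :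
    f 1 ^ 2 * f (a * b + b * a) =
      f 1 ^ 2 * f a * (f 1 ^ 2 * f b) + f 1 ^ 2 * f b * (f 1 ^ 2 * f a) := by
  have h := hf a b 1 1
  simp only [tetrad, one_mul, mul_one] at h
  have ca := (unit_comm hf a).pow_left 2
  have cb := (unit_comm hf b).pow_left 2
  have key {p q : R} (hp : Commute (f 1 ^ 2) p) :
      f 1 ^ 2 * p * (f 1 ^ 2 * q) = f 1 ^ 2 * (f 1 ^ 2 * (p * q)) := by
    rw [mul_assoc, ← mul_assoc p, ← hp.eq, mul_assoc (f 1 ^ 2) p]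
  rw [h, key ca, key cb, mul_assoc _ (f 1) (f 1), ← sq, ← (ca.mul_right cb).eq,
    mul_assoc (f 1 ^ 2) (f b), mul_add]

end TetradMap

/-! ### The Clifford relations -/

/-- The eight monomials in three Clifford type generators, together with a local unit. -/
def cliffordWord {R : Type*} [Ring R] (e h x y : R) : Fin 8 → R :=
  ![e, h, x, y, h * x, h * y, x * y, h * x * y]

/-- The relations move every generator into the order `h`, `x`, `y` and reduce squares, so left
multiplication keeps the span of the ordered monomials. -/
theorem mul_cliffordWord_mem {F R : Type*} [Field F] [Ring R] [Algebra F R] {e h x y : R}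
    (ey : e * y = y) (he : h * e = h) (xe : x * e = x)
    (ye : y * e = y) (hh : h * h = h) (xx : x * x = 0) (yy : y * y = 0) (hx : x * h = x - h * x)
    (hy : y * h = y - h * y) (xy : y * x = e - x * y) (k : Fin 8) :
    h * cliffordWord e h x y k ∈ Submodule.span F (Set.range (cliffordWord e h x y)) ∧
    x * cliffordWord e h x y k ∈ Submodule.span F (Set.range (cliffordWord e h x y)) ∧
    y * cliffordWord e h x y k ∈ Submodule.span F (Set.range (cliffordWord e h x y)) := by
  have m (i : Fin 8) : cliffordWord e h x y i ∈
      Submodule.span F (Set.range (cliffordWord e h x y)) :=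
    Submodule.subset_span (Set.mem_range_self i)
  generalize hS : Submodule.span F (Set.range (cliffordWord e h x y)) = S at *
  have m0 : e ∈ S := m 0
  have m1 : h ∈ S := m 1
  have m2 : x ∈ S := m 2
  have m3 : y ∈ S := m 3
  have m4 : h * x ∈ S := m 4
  have m5 : h * y ∈ S := m 5
  have m6 : x * y ∈ S := m 6
  have m7 : h * x * y ∈ S := m 7
  have mz := S.zero_mem
  have ms {a b : R} (ha : a ∈ S) (hb : b ∈ S) : a - b ∈ S := S.sub_mem ha hb
  have hhx : h * (h * x) = h * x := by rw [← mul_assoc, hh]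
  have hhy : h * (h * y) = h * y := by rw [← mul_assoc, hh]
  have hhxy : h * (h * x * y) = h * x * y := by rw [← mul_assoc, hhx]
  have xhx : x * (h * x) = 0 := by rw [← mul_assoc, hx, sub_mul, mul_assoc, xx, mul_zero, sub_zero]
  have xhy : x * (h * y) = x * y - h * x * y := by rw [← mul_assoc, hx, sub_mul]
  have xxy : x * (x * y) = 0 := by rw [← mul_assoc, xx, zero_mul]
  have xhxy : x * (h * x * y) = 0 := by rw [← mul_assoc, xhx, zero_mul]
  have yhx : y * (h * x) = (e - x * y) - (h - h * x * y) := by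
    rw [← mul_assoc, hy, sub_mul, mul_assoc, xy, mul_sub, he, mul_assoc]
  have yhy : y * (h * y) = 0 := by rw [← mul_assoc, hy, sub_mul, mul_assoc, yy, mul_zero, sub_zero]
  have yxy : y * (x * y) = y := by
    rw [← mul_assoc, xy, sub_mul, mul_assoc, yy, mul_zero, sub_zero, ey]
  have yhxy : y * (h * x * y) = y - h * y := by
    rw [← mul_assoc, yhx]
    simp only [sub_mul, mul_assoc, yy, mul_zero, sub_zero, ey]
  fin_cases k <;> refine ⟨?_, ?_, ?_⟩ <;>
    simp only [cliffordWord, Fin.reduceFinMk, Fin.zero_eta, Fin.mk_one, Fin.isValue,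
      Matrix.cons_val, Matrix.cons_val_zero, Matrix.cons_val_one] <;>
    try simp only [he, xe, ye, hh, xx, yy, hx, hy, xy, xhx, xhy, xxy, xhxy, yhx, yhy, yxy, yhxy, hhx, hhy, hhxy]
  all_goals first
    | assumption
    | (rw [← mul_assoc]; assumption)
    | exact ms m2 m4
    | exact ms m3 m5
    | exact ms m0 m6
    | exact ms m6 m7
    | exact ms (ms m0 m6) (ms m1 m7)

/-! ### Tetrad-preserving maps on two by two matrices -/

section MatrixTwo

open Matrix

variable {F R : Type*} [Field F] [CharZero F] [Ring R] [Algebra F R]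
  {f : Matrix (Fin 2) (Fin 2) F →ₗ[F] R}

/-- A spanning family of the algebra generated by a tetrad-preserving map on `M₂(F)`. -/
def envelopeWord (f : Matrix (Fin 2) (Fin 2) F →ₗ[F] R) : Option (Fin 3 × Fin 8) → R
  | none => 1
  | some (i, k) => f 1 ^ (i : ℕ) * cliffordWord (f 1 ^ 3) (f 1 ^ 2 * f (single 0 0 1))
      (f 1 ^ 2 * f (single 0 1 1)) (f 1 ^ 2 * f (single 1 0 1)) k

variable (hf : ∀ a b c d, f (tetrad a b c d) = tetrad (f a) (f b) (f c) (f d))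

include hf

theorem mul_mem_span_envelopeWord (a : Matrix (Fin 2) (Fin 2) F) (t : R)
    (ht : t ∈ Submodule.span F (Set.range (envelopeWord f))) :
    f a * t ∈ Submodule.span F (Set.range (envelopeWord f)) := by
  set s : Matrix (Fin 2) (Fin 2) F →ₗ[F] R := LinearMap.mulLeft F (f 1 ^ 2) ∘ₗ f with hs
  have s_apply (a) : s a = f 1 ^ 2 * f a := rfl
  have jordan (a b) : s (a * b + b * a) = s a * s b + s b * s a := unit_sq_mul_jordan hf a b
  have us (m : ℕ) (a) : Commute (f 1 ^ m) (s a) :=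
    (((Commute.refl (f 1)).pow_right 2).mul_right (unit_comm hf a)).pow_left m
  have es (a) : f 1 ^ 3 * s a = s a := by
    rw [(us 3 a).eq, s_apply, mul_assoc, mul_unit_cube hf]
  have se (a) : s a * f 1 ^ 3 = s a := by rw [← (us 3 a).eq, es]
  have s_one : s 1 = f 1 ^ 3 := by rw [s_apply, ← pow_succ]
  have fs (a) : f a = f 1 * s a := by
    rw [s_apply, ← mul_assoc, ← pow_succ', unit_cube_mul hf]
  have half {p q : R} (hpq : p + p = q + q) : p = q := by
    have h2 : (2 : F) • (p - q) = 0 := by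
      rw [two_smul]
      linear_combination (norm := noncomm_ring) hpq
    exact sub_eq_zero.1 ((smul_eq_zero.1 h2).resolve_left two_ne_zero)
  have hh : s (single 0 0 1) * s (single 0 0 1) = s (single 0 0 1) := by
    apply half
    rw [← jordan, ← map_add]
    simp
  have xx : s (single 0 1 1) * s (single 0 1 1) = 0 := by
    apply half
    rw [← jordan]
    simp
  have yy : s (single 1 0 1) * s (single 1 0 1) = 0 := by
    apply half
    rw [← jordan]
    simp
  have hx : s (single 0 1 1) * s (single 0 0 1) =
      s (single 0 1 1) - s (single 0 0 1) * s (single 0 1 1) := by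
    rw [eq_sub_iff_add_eq, ← jordan]
    simp
  have hy : s (single 1 0 1) * s (single 0 0 1) =
      s (single 1 0 1) - s (single 0 0 1) * s (single 1 0 1) := by
    rw [eq_sub_iff_add_eq, ← jordan]
    simp
  have xy : s (single 1 0 1) * s (single 0 1 1) =
      f 1 ^ 3 - s (single 0 1 1) * s (single 1 0 1) := by
    rw [eq_sub_iff_add_eq, ← jordan, ← s_one]
    congr 1
    ext i j
    fin_cases i <;> fin_cases j <;> simp
  set w := cliffordWord (f 1 ^ 3) (s (single 0 0 1)) (s (single 0 1 1)) (s (single 1 0 1)) with hw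
  have e_word (k) : f 1 ^ 3 * w k = w k := by
    have ee : f 1 ^ 3 * f 1 ^ 3 = f 1 ^ 3 := by simpa only [s_one] using es 1
    fin_cases k <;> simp [hw, cliffordWord, ← mul_assoc, es, ee]
  have key := mul_cliffordWord_mem (F := F) (es _) (se _) (se _) (se _) hh xx yy
    hx hy xy
  have s_word (a k) : s a * w k ∈ Submodule.span F (Set.range w) := by
    -- `E₂₂` is written as `1 - E₁₁`, so that only `e`, `h`, `x`, `y` are needed.
    have ha : a = a 0 0 • single 0 0 1 + a 0 1 • single 0 1 1 + a 1 0 • single 1 0 1 +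
        a 1 1 • (1 - single 0 0 1) := by
      ext i j
      fin_cases i <;> fin_cases j <;> simp
    rw [ha]
    simp only [map_add, map_smul, map_sub, s_one, add_mul, smul_mul_assoc, sub_mul, e_word]
    have m := Submodule.subset_span (R := F) (Set.mem_range_self (f := w) k)
    exact add_mem (add_mem (add_mem (Submodule.smul_mem _ _ (key k).1)
      (Submodule.smul_mem _ _ (key k).2.1)) (Submodule.smul_mem _ _ (key k).2.2))
      (Submodule.smul_mem _ _ (sub_mem m (key k).1))
  have pow_mem (i : Fin 3) (v) (hv : v ∈ Submodule.span F (Set.range w)) :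
      f 1 ^ ((i : ℕ) + 1) * v ∈ Submodule.span F (Set.range (envelopeWord f)) := by
    induction hv using Submodule.span_induction with
    | mem v hv =>
      obtain ⟨k, rfl⟩ := hv
      have m (j : Fin 3) : f 1 ^ (j : ℕ) * w k ∈
          Submodule.span F (Set.range (envelopeWord f)) :=
        Submodule.subset_span ⟨some (j, k), rfl⟩
      fin_cases i
      · exact m 1
      · exact m 2
      -- The exponent wraps around: `u ^ 3` fixes each word, so it may be replaced by `u ^ 0`.
      · have := m 0
        rw [Fin.val_zero, pow_zero, one_mul, ← e_word] at this
        exact this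
    | zero => simp
    | add p q _ _ hp hq =>
      rw [mul_add]
      exact add_mem hp hq
    | smul c p _ hp =>
      rw [mul_smul_comm]
      exact Submodule.smul_mem _ _ hp
  induction ht using Submodule.span_induction with
  | mem t ht =>
    obtain ⟨_ | ⟨i, k⟩, rfl⟩ := ht
    -- The word 1 lies outside the 24 others; `f a * 1 = u * (s a * e)` lands among them.
    · have := pow_mem 0 _ (s_word a 0)
      have h0 : s a * w 0 = s a := se a
      rw [h0, Fin.val_zero, zero_add, pow_one, ← fs] at this
      simpa [envelopeWord] using this
    · have : f a * envelopeWord f (some (i, k)) = f 1 ^ ((i : ℕ) + 1) * (s a * w k) := by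
        change f a * (f 1 ^ (i : ℕ) * w k) = _
        rw [fs, pow_succ', mul_assoc, mul_assoc, ← mul_assoc (s a), ← (us i a).eq, mul_assoc]
      rw [this]
      exact pow_mem i _ (s_word a k)
  | zero => simp
  | add p q _ _ hp hq =>
    rw [mul_add]
    exact add_mem hp hq
  | smul c p _ hp =>
    rw [mul_smul_comm]
    exact Submodule.smul_mem _ _ hp

theorem span_envelopeWord_eq_top (hgen : Algebra.adjoin F (Set.range f) = ⊤) :
    Submodule.span F (Set.range (envelopeWord f)) = ⊤ := by
  refine Submodule.eq_top_iff'.2 fun t => ?_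
  suffices h : ∀ v ∈ Submodule.span F (Set.range (envelopeWord f)),
      t * v ∈ Submodule.span F (Set.range (envelopeWord f)) by
    simpa using h 1 (Submodule.subset_span ⟨none, rfl⟩)
  have ht : t ∈ Algebra.adjoin F (Set.range f) := hgen ▸ Algebra.mem_top
  induction ht using Algebra.adjoin_induction with
  | mem x hx =>
    obtain ⟨a, rfl⟩ := hx
    exact mul_mem_span_envelopeWord hf a
  | algebraMap r =>
    intro v hv
    rw [← Algebra.smul_def]
    exact Submodule.smul_mem _ _ hv
  | add x y _ _ hx hy =>
    intro v hv
    rw [add_mul]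
    exact add_mem (hx v hv) (hy v hv)
  | mul x y _ _ hx hy =>
    intro v hv
    rw [mul_assoc]
    exact hx _ (hy v hv)

theorem finite_of_adjoin_range_eq_top (hgen : Algebra.adjoin F (Set.range f) = ⊤) :
    Module.Finite F R :=
  ⟨Submodule.fg_def.2 ⟨_, Set.finite_range _, span_envelopeWord_eq_top hf hgen⟩⟩

theorem finrank_le_of_adjoin_range_eq_top (hgen : Algebra.adjoin F (Set.range f) = ⊤) :
    Module.finrank F R ≤ 25 := by
  have h := finrank_range_le_card (R := F) (envelopeWord f)
  rwa [Set.finrank, span_envelopeWord_eq_top hf hgen, finrank_top] at h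

end MatrixTwo

/-! ### The universal property of the envelope -/

namespace SpecialJQS

variable {F : Type u} {A : Type v} [Field F] [Ring A] [Algebra F A] (J : SpecialJQS F A)

namespace Env

/-- The universal map from a special Jordan quadruple system to its envelope. -/
def of : J.Carrier →ₗ[F] J.Env :=
  (RingQuot.mkAlgHom F J.EnvRel).toLinearMap ∘ₗ TensorAlgebra.ι F

theorem of_quad (a b c d : J.Carrier) :
    of J (J.quad a b c d) = tetrad (of J a) (of J b) (of J c) (of J d) := by
  have h := RingQuot.mkAlgHom_rel F (EnvRel.of (J := J) a b c d)
  simp only [tetrad, map_add, map_mul] at h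
  exact h.symm

theorem adjoin_range_of : Algebra.adjoin F (Set.range (of J)) = ⊤ := by
  have h : Set.range (of J) = RingQuot.mkAlgHom F J.EnvRel '' Set.range (TensorAlgebra.ι F) := by
    rw [← Set.range_comp]
    rfl
  rw [h, ← AlgHom.map_adjoin, TensorAlgebra.adjoin_range_ι, Algebra.map_top,
    AlgHom.range_eq_top]
  exact RingQuot.mkAlgHom_surjective F J.EnvRel

variable {J} {E : Type*} [Ring E] [Algebra F E]

/-- A tetrad-preserving linear map extends to the envelope. -/
def lift (f : J.Carrier →ₗ[F] E)
    (hf : ∀ a b c d, f (J.quad a b c d) = tetrad (f a) (f b) (f c) (f d)) : J.Env →ₐ[F] E :=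
  RingQuot.liftAlgHom F ⟨TensorAlgebra.lift F f, by
    rintro _ _ ⟨a, b, c, d⟩
    simp [tetrad, hf]⟩

@[simp]
theorem lift_of (f : J.Carrier →ₗ[F] E)
    (hf : ∀ a b c d, f (J.quad a b c d) = tetrad (f a) (f b) (f c) (f d)) (a : J.Carrier) :
    lift f hf (of J a) = f a := by
  simp [lift, of]

variable {K : Type*} [Field K] [Algebra F K] [Algebra K E] [IsScalarTower F K E]

/-- A tetrad-preserving linear map into an algebra over an extension field extends to the
envelope after extension of scalars. -/
def baseLift (f : J.Carrier →ₗ[F] E)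
    (hf : ∀ a b c d, f (J.quad a b c d) = tetrad (f a) (f b) (f c) (f d)) :
    K ⊗[F] J.Env →ₐ[K] E :=
  Algebra.TensorProduct.lift (Algebra.ofId K E) (lift f hf)
    (fun x _ => Algebra.commute_algebraMap_left x _)

@[simp]
theorem baseLift_tmul_of (f : J.Carrier →ₗ[F] E)
    (hf : ∀ a b c d, f (J.quad a b c d) = tetrad (f a) (f b) (f c) (f d)) (a : J.Carrier) :
    baseLift (K := K) f hf (1 ⊗ₜ of J a) = f a :=
  (Algebra.TensorProduct.lift_tmul _ _ _ _ _).trans (by rw [map_one, one_mul, lift_of])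

end Env

end SpecialJQS

/-! ### The structure of the envelope of `A₂` -/

namespace systemA

open Matrix SpecialJQS

/-- An element of `A_n` given by a matrix. -/
def ofMatrix (n : ℕ) (F : Type*) [Field F] :
    Matrix (Fin n) (Fin n) F →ₗ[F] (systemA n F).Carrier where
  toFun a := ⟨a, trivial⟩
  map_add' _ _ := rfl
  map_smul' _ _ := rfl

@[simp]
theorem coe_ofMatrix {n : ℕ} {F : Type*} [Field F] (a : Matrix (Fin n) (Fin n) F) :
    (ofMatrix n F a : Matrix (Fin n) (Fin n) F) = a :=
  rfl

theorem ofMatrix_surjective (n : ℕ) (F : Type*) [Field F] :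
    Function.Surjective (ofMatrix n F) :=
  fun a => ⟨a, rfl⟩

theorem quad_ofMatrix {n : ℕ} {F : Type*} [Field F] (a b c d : Matrix (Fin n) (Fin n) F) :
    (systemA n F).quad (ofMatrix n F a) (ofMatrix n F b) (ofMatrix n F c) (ofMatrix n F d) =
      ofMatrix n F (tetrad a b c d) :=
  rfl

variable {F : Type*} [Field F]

theorem adjoin_range_of_ofMatrix (n : ℕ) :
    Algebra.adjoin F (Set.range (Env.of (systemA n F) ∘ₗ ofMatrix n F)) = ⊤ := by
  rw [← Env.adjoin_range_of]
  congr 1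
  rw [LinearMap.coe_comp, (ofMatrix_surjective n F).range_comp]

theorem of_ofMatrix_tetrad {n : ℕ} (a b c d : Matrix (Fin n) (Fin n) F) :
    (Env.of (systemA n F) ∘ₗ ofMatrix n F) (tetrad a b c d) =
      tetrad ((Env.of (systemA n F) ∘ₗ ofMatrix n F) a) ((Env.of (systemA n F) ∘ₗ ofMatrix n F) b)
        ((Env.of (systemA n F) ∘ₗ ofMatrix n F) c) ((Env.of (systemA n F) ∘ₗ ofMatrix n F) d) := by
  simp only [LinearMap.comp_apply, ← Env.of_quad, quad_ofMatrix]

instance finite_env [CharZero F] : Module.Finite F (systemA 2 F).Env :=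
  finite_of_adjoin_range_eq_top of_ofMatrix_tetrad (adjoin_range_of_ofMatrix 2)

theorem finrank_env_le [CharZero F] : Module.finrank F (systemA 2 F).Env ≤ 25 :=
  finrank_le_of_adjoin_range_eq_top of_ofMatrix_tetrad
    (adjoin_range_of_ofMatrix 2)

/-! ### The split model and the lower bound -/

variable {K : Type*} [Field K] [Algebra F K]

/-- The natural representation and its transpose, twisted by powers of a scalar. -/
def twist (w : K) (i : Fin 6) :
    (systemA 2 F).Carrier →ₗ[F] Matrix (Fin 2) (Fin 2) K where
  toFun a := w ^ (i : ℕ) •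
    if Even (i : ℕ) then a.1.map (algebraMap F K) else (a.1.map (algebraMap F K))ᵀ
  map_add' a b := by
    split_ifs <;> ext <;> simp [mul_add]
  map_smul' c a := by
    split_ifs <;> ext <;>
      simp only [Submodule.coe_smul, Matrix.smul_apply, transpose_apply, map_apply, smul_eq_mul, map_mul,
        RingHom.id_apply, Algebra.smul_def (R := F) (A := K)] <;> ring

/-- Transposition reverses products, which only swaps the two terms of the tetrad; the scalar
satisfies `(w ^ i) ^ 4 = w ^ i`. -/
theorem twist_quad {w : K} (hw : w ^ 3 = 1) (i : Fin 6) (a b c d : (systemA 2 F).Carrier) :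
    twist w i ((systemA 2 F).quad a b c d) =
      tetrad (twist w i a) (twist w i b) (twist w i c) (twist w i d) := by
  have h4 : w ^ (i : ℕ) * w ^ (i : ℕ) * w ^ (i : ℕ) * w ^ (i : ℕ) = w ^ (i : ℕ) := by
    have : (w ^ (i : ℕ)) ^ 3 = 1 := by rw [← pow_mul, mul_comm, pow_mul, hw, one_pow]
    linear_combination w ^ (i : ℕ) * this
  simp only [twist, LinearMap.coe_mk, AddHom.coe_mk, tetrad, quad, smul_mul_smul_comm, h4,
    ← smul_add]
  congr 1
  split_ifs
  · simp [Matrix.map_add, Matrix.map_mul]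
  · rw [add_comm]
    simp [Matrix.map_add, Matrix.map_mul, Matrix.transpose_mul, mul_assoc]

/-- The split semisimple algebra `K ⊕ 6 M₂(K)`. -/
abbrev Model (K : Type*) [Field K] := K × (Fin 6 → Matrix (Fin 2) (Fin 2) K)

/-- The tetrad-preserving map from `A₂` to `K ⊕ 6 M₂(K)`. -/
def toModel (w : K) : (systemA 2 F).Carrier →ₗ[F] Model K :=
  LinearMap.prod 0 (LinearMap.pi (twist w))

theorem toModel_quad {w : K} (hw : w ^ 3 = 1) (a b c d : (systemA 2 F).Carrier) :
    toModel w ((systemA 2 F).quad a b c d) =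
      tetrad (toModel w a) (toModel w b) (toModel w c) (toModel w d) := by
  refine Prod.ext ?_ (funext fun i => twist_quad hw i a b c d)
  simp [toModel, tetrad]

theorem twist_one (w : K) (i : Fin 6) : twist w i (ofMatrix 2 F 1) = w ^ (i : ℕ) • 1 := by
  simp [twist]

theorem twist_single (w : K) (i : Fin 6) (j k : Fin 2) :
    twist w i (ofMatrix 2 F (single j k 1)) =
      w ^ (i : ℕ) • if Even (i : ℕ) then single j k 1 else single k j 1 := by
  simp [twist]

/-- Orthogonality of the characters of ℤ/3. The constant term is written `(w ^ j) ^ 3` so that the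
sum is a polynomial in `w ^ j` without constant term. -/
theorem sum_cubeRoot {w : K} (hw : w ^ 2 + w + 1 = 0) (hw3 : w ^ 3 = 1) [CharZero K] (i j : ℕ) :
    (3⁻¹ * ((w ^ j) ^ 3 + w ^ (2 * i) * w ^ j + w ^ i * (w ^ j) ^ 2) : K) =
      if j % 3 = i % 3 then 1 else 0 := by
  have key (n : ℕ) : w ^ n = w ^ (n % 3) := by
    conv_lhs => rw [← Nat.div_add_mod n 3, pow_add, pow_mul, hw3, one_pow, one_mul]
  have h0 : j * 3 % 3 = 0 := by omega
  rw [← pow_mul, ← pow_mul, ← pow_add, ← pow_add, key (j * 3), key (2 * i + j),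
    key (i + j * 2), h0]
  have h : j % 3 = i % 3 ∧ (2 * i + j) % 3 = 0 ∧ (i + j * 2) % 3 = 0 ∨
      j % 3 ≠ i % 3 ∧ (2 * i + j) % 3 = 1 ∧ (i + j * 2) % 3 = 2 ∨
      j % 3 ≠ i % 3 ∧ (2 * i + j) % 3 = 2 ∧ (i + j * 2) % 3 = 1 := by
    have hi : i % 3 = 0 ∨ i % 3 = 1 ∨ i % 3 = 2 := by omega
    have hj : j % 3 = 0 ∨ j % 3 = 1 ∨ j % 3 = 2 := by omega
    rcases hi with hi | hi | hi <;> rcases hj with hj | hj | hj <;> omega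
  rcases h with ⟨h, h1, h2⟩ | ⟨h, h1, h2⟩ | ⟨h, h1, h2⟩
  · rw [h1, h2, if_pos h]
    norm_num
  · rw [h1, h2, if_neg h]
    linear_combination 3⁻¹ * hw
  · rw [h1, h2, if_neg h]
    linear_combination 3⁻¹ * hw

theorem toModel_fst (w : K) (a : (systemA 2 F).Carrier) : (toModel w a).1 = 0 := rfl

theorem toModel_snd (w : K) (a : (systemA 2 F).Carrier) (i : Fin 6) :
    (toModel w a).2 i = twist w i a := rfl

/-- The subalgebra generated by the image of `A₂`. -/
abbrev modelSubalgebra (F : Type*) [Field F] {K : Type*} [Field K] [Algebra F K] (w : K) :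
    Subalgebra K (Model K) :=
  Algebra.adjoin K (Set.range (toModel (F := F) w))

theorem toModel_mem (w : K) (a : (systemA 2 F).Carrier) : toModel w a ∈ modelSubalgebra F w :=
  Algebra.subset_adjoin ⟨a, rfl⟩

theorem exists_cubeRoot_projection [CharZero K] {w : K} (hw : w ^ 2 + w + 1 = 0)
    (hw3 : w ^ 3 = 1) (i : Fin 6) : ∃ p ∈ modelSubalgebra F w, p.1 = 0 ∧
      ∀ j : Fin 6, p.2 j = if (j : ℕ) % 3 = (i : ℕ) % 3 then 1 else 0 := by
  have mem := toModel_mem w (ofMatrix 2 F 1)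
  refine ⟨(3⁻¹ : K) • (toModel w (ofMatrix 2 F 1) ^ 3 +
    w ^ (2 * (i : ℕ)) • toModel w (ofMatrix 2 F 1) +
    w ^ (i : ℕ) • toModel w (ofMatrix 2 F 1) ^ 2), ?_, ?_, fun j => ?_⟩
  · exact Subalgebra.smul_mem _ (add_mem (add_mem (pow_mem mem 3) (Subalgebra.smul_mem _ mem _))
      (Subalgebra.smul_mem _ (pow_mem mem 2) _)) _
  · simp [toModel_fst]
  · simp only [Prod.smul_snd, Prod.snd_add, Prod.pow_snd, Pi.smul_apply, Pi.add_apply,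
      Pi.pow_apply, toModel_snd, twist_one, smul_pow, one_pow, smul_smul, ← add_smul,
      sum_cubeRoot hw hw3]
    split_ifs <;> simp

/-- `E₁₁E₁₂E₂₁ + E₂₁E₁₁E₁₂ = 1`, while the transposed units give `E₁₁E₂₁E₁₂ + E₁₂E₁₁E₂₁ = 0`. The
degree is three, so the twisting scalars disappear. -/
theorem exists_even_projection {w : K} (hw3 : w ^ 3 = 1) :
    ∃ g ∈ modelSubalgebra F w, g.1 = 0 ∧ ∀ j : Fin 6, g.2 j = if Even (j : ℕ) then 1 else 0 := by
  have mem (a) := toModel_mem w (ofMatrix 2 F a)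
  refine ⟨toModel w (ofMatrix 2 F (single 0 0 1)) * toModel w (ofMatrix 2 F (single 0 1 1)) *
      toModel w (ofMatrix 2 F (single 1 0 1)) +
    toModel w (ofMatrix 2 F (single 1 0 1)) * toModel w (ofMatrix 2 F (single 0 0 1)) *
      toModel w (ofMatrix 2 F (single 0 1 1)), ?_, ?_, fun j => ?_⟩
  · exact add_mem (mul_mem (mul_mem (mem _) (mem _)) (mem _))
      (mul_mem (mul_mem (mem _) (mem _)) (mem _))
  · simp [toModel_fst]
  · have h3 : w ^ (j : ℕ) * w ^ (j : ℕ) * w ^ (j : ℕ) = 1 := by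
      rw [← pow_three', ← pow_mul, mul_comm, pow_mul, hw3, one_pow]
    simp only [Prod.snd_add, Prod.snd_mul, Pi.add_apply, Pi.mul_apply, toModel_snd, twist_single,
      smul_mul_smul_comm, h3, one_smul]
    split_ifs
    · ext k l
      fin_cases k <;> fin_cases l <;> simp
    · simp

theorem single_one_mem_modelSubalgebra [CharZero K] {w : K} (hw : w ^ 2 + w + 1 = 0)
    (hw3 : w ^ 3 = 1) (i : Fin 6) : ((0, Pi.single i 1) : Model K) ∈ modelSubalgebra F w := by
  obtain ⟨p, hp, hp1, hp2⟩ := exists_cubeRoot_projection (F := F) hw hw3 i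
  obtain ⟨g, hg, hg1, hg2⟩ := exists_even_projection (F := F) hw3
  have : ((0, Pi.single i 1) : Model K) = if Even (i : ℕ) then p * g else p - p * g := by
    refine Prod.ext ?_ (funext fun j => ?_)
    · split_ifs <;> simp [hp1]
    -- By the Chinese remainder theorem an index below 6 is determined by its residues modulo 3 and
    -- 2.
    · have hij : j = i ↔ (j : ℕ) % 3 = (i : ℕ) % 3 ∧ (j : ℕ) % 2 = (i : ℕ) % 2 := by
        rw [Fin.ext_iff]
        omega
      rw [apply_ite Prod.snd, ite_apply]
      simp only [Prod.snd_mul, Prod.snd_sub, Pi.mul_apply, Pi.sub_apply, hp2, hg2,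
        Pi.single_apply, hij, Nat.even_iff]
      rcases Nat.mod_two_eq_zero_or_one i with h | h <;>
        rcases Nat.mod_two_eq_zero_or_one j with h' | h' <;> simp [h, h']
  rw [this]
  split_ifs
  · exact mul_mem hp hg
  · exact sub_mem hp (mul_mem hp hg)

theorem single_mem_modelSubalgebra [CharZero K] {w : K} (hw : w ^ 2 + w + 1 = 0)
    (hw3 : w ^ 3 = 1) (i : Fin 6) (m : Matrix (Fin 2) (Fin 2) K) :
    ((0, Pi.single i m) : Model K) ∈ modelSubalgebra F w := by
  have unit (k l : Fin 2) : ((0, Pi.single i (single k l 1)) : Model K) ∈ modelSubalgebra F w := by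
    have hwi : w ^ (2 * (i : ℕ)) * w ^ (i : ℕ) = 1 := by
      rw [← pow_add, ← add_one_mul, pow_mul, two_add_one_eq_three, hw3, one_pow]
    have : ((0, Pi.single i (single k l 1)) : Model K) =
        (0, Pi.single i 1) * w ^ (2 * (i : ℕ)) • toModel w (ofMatrix 2 F
          (if Even (i : ℕ) then single k l 1 else single l k 1)) := by
      refine Prod.ext (by simp) (funext fun j => ?_)
      rcases eq_or_ne j i with rfl | hj
      · simp only [Prod.snd_mul, Prod.smul_snd, Pi.mul_apply, Pi.smul_apply, toModel_snd,
          Pi.single_eq_same, one_mul]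
        split_ifs with he <;> rw [twist_single, smul_smul, hwi, one_smul] <;> simp [he]
      · simp [Pi.single_eq_of_ne hj]
    rw [this]
    exact mul_mem (single_one_mem_modelSubalgebra hw hw3 i)
      (Subalgebra.smul_mem _ (toModel_mem _ _) _)
  have : ((0, Pi.single i m) : Model K) =
      ∑ k, ∑ l, m k l • ((0, Pi.single i (single k l 1)) : Model K) := by
    have h : m = ∑ k, ∑ l, m k l • single k l (1 : K) := by
      simpa [smul_single] using matrix_eq_sum_single m
    have hL : ((0, Pi.single i m) : Model K) =
        (LinearMap.inr K K _ ∘ₗ LinearMap.single K _ i) m := rfl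
    rw [hL]
    conv_lhs => rw [h]
    simp only [map_sum, map_smul]
    rfl
  rw [this]
  exact sum_mem fun k _ => sum_mem fun l _ => Subalgebra.smul_mem _ (unit k l) _

theorem modelSubalgebra_eq_top [CharZero K] {w : K} (hw : w ^ 2 + w + 1 = 0) (hw3 : w ^ 3 = 1) :
    modelSubalgebra F w = ⊤ := by
  refine Algebra.eq_top_iff.2 fun x => ?_
  -- The idempotent of the one-dimensional factor is 1 minus the six block identities.
  have : x = x.1 • (1 - ∑ i, (0, Pi.single i 1)) + ∑ i, ((0, Pi.single i (x.2 i)) : Model K) := by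
    refine Prod.ext (by simp [Prod.fst_sum]) (funext fun j => ?_)
    simp [Prod.snd_sum, Finset.sum_apply, Pi.single_apply, Finset.sum_ite_eq]
  rw [this]
  exact add_mem (Subalgebra.smul_mem _ (sub_mem (one_mem _)
    (sum_mem fun i _ => single_one_mem_modelSubalgebra hw hw3 i)) _)
    (sum_mem fun i _ => single_mem_modelSubalgebra hw hw3 i _)

theorem finrank_model : Module.finrank K (Model K) = 25 := by
  simp [Module.finrank_prod, Module.finrank_pi_fintype, Module.finrank_matrix]

/-- The comparison map from the envelope to `K ⊕ 6 M₂(K)`. -/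
def envToModel {w : K} (hw : w ^ 3 = 1) : K ⊗[F] (systemA 2 F).Env →ₐ[K] Model K :=
  Env.baseLift (toModel w) (toModel_quad hw)

theorem envToModel_surjective [CharZero K] {w : K} (hw : w ^ 2 + w + 1 = 0) (hw3 : w ^ 3 = 1) :
    Function.Surjective (envToModel (F := F) hw3) := by
  rw [← AlgHom.range_eq_top, eq_top_iff, ← modelSubalgebra_eq_top (F := F) hw hw3, Algebra.adjoin_le_iff]
  rintro _ ⟨a, rfl⟩
  exact ⟨1 ⊗ₜ Env.of _ a, Env.baseLift_tmul_of _ _ a⟩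

theorem envToModel_bijective [CharZero F] [CharZero K] {w : K} (hw : w ^ 2 + w + 1 = 0) (hw3 : w ^ 3 = 1) :
    Function.Bijective (envToModel (F := F) hw3) ∧
      Module.finrank F (systemA 2 F).Env = 25 := by
  have hs := envToModel_surjective (F := F) hw hw3
  have h1 : Module.finrank K (K ⊗[F] (systemA 2 F).Env) = Module.finrank F (systemA 2 F).Env :=
    Module.finrank_baseChange
  have h2 := LinearMap.finrank_le_finrank_of_surjective
    (f := (envToModel (F := F) hw3).toLinearMap) hs
  have h3 := finrank_env_le (F := F)
  rw [finrank_model] at h2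
  have h4 : Module.finrank F (systemA 2 F).Env = 25 := by omega
  refine ⟨⟨?_, hs⟩, h4⟩
  exact (LinearMap.injective_iff_surjective_of_finrank_eq_finrank
    (f := (envToModel (F := F) hw3).toLinearMap) (by rw [finrank_model, h1, h4])).2 hs

end systemA

/-! ### Representations and the envelope -/

namespace SpecialJQS.Rep

variable {F : Type u} {A : Type v} [Field F] [Ring A] [Algebra F A] {J : SpecialJQS F A}
  {K : Type*} [Field K] [Algebra F K] {V W : Type*} [AddCommGroup V] [Module K V]
  [AddCommGroup W] [Module K W]

theorem Iso.symm {ρ : J.Rep K V} {σ : J.Rep K W} (h : ρ.Iso σ) : σ.Iso ρ := by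
  obtain ⟨e, he⟩ := h
  refine ⟨e.symm, fun a x => ?_⟩
  rw [LinearEquiv.symm_apply_eq, he, LinearEquiv.apply_symm_apply]

/-- Schur's lemma: a nonzero intertwining map between irreducible representations is an
isomorphism. -/
theorem IsIrreducible.iso_of_ne_zero {ρ : J.Rep K V} {σ : J.Rep K W} (hρ : ρ.IsIrreducible)
    (hσ : σ.IsIrreducible) (T : V →ₗ[K] W) (hT : ∀ a x, T (ρ.toFun a x) = σ.toFun a (T x))
    (h0 : T ≠ 0) : ρ.Iso σ := by
  have hker : LinearMap.ker T = ⊥ := by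
    refine (hρ.2 (LinearMap.ker T) fun a x hx => ?_).resolve_right
      fun h => h0 (LinearMap.ker_eq_top.1 h)
    rw [LinearMap.mem_ker, hT, LinearMap.mem_ker.1 hx, map_zero]
  have hrange : LinearMap.range T = ⊤ := by
    refine (hσ.2 (LinearMap.range T) ?_).resolve_left fun h => h0 (LinearMap.range_eq_bot.1 h)
    rintro a _ ⟨x, rfl⟩
    exact ⟨_, hT a x⟩
  exact ⟨LinearEquiv.ofBijective T ⟨LinearMap.ker_eq_bot.1 hker, LinearMap.range_eq_top.1 hrange⟩,
    hT⟩

/-- A representation extends to the envelope after extension of scalars. -/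
theorem exists_algHom (σ : J.Rep K V) :
    ∃ L : K ⊗[F] J.Env →ₐ[K] Module.End K V, ∀ a, L (1 ⊗ₜ Env.of J a) = σ.toFun a := by
  -- Restriction of scalars turns the semilinear map into an `F`-linear one.
  let _ : Module F V := Module.compHom V (algebraMap F K)
  have : IsScalarTower F K V := ⟨fun c k x => by
    rw [Algebra.smul_def, mul_smul]
    rfl⟩
  let f : J.Carrier →ₗ[F] Module.End K V :=
    { toFun := σ.toFun
      map_add' := σ.toFun.map_add
      map_smul' := fun c a => by
        rw [σ.toFun.map_smulₛₗ]
        rfl }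
  exact ⟨Env.baseLift f σ.map_quad, Env.baseLift_tmul_of f σ.map_quad⟩

/-- A representation on column vectors given by a tetrad-preserving family of matrices. -/
noncomputable def ofMatrices {n : ℕ} (f : J.Carrier →ₗ[F] Matrix (Fin n) (Fin n) K)
    (hf : ∀ a b c d, f (J.quad a b c d) = tetrad (f a) (f b) (f c) (f d)) :
    J.Rep K (Fin n → K) where
  toFun :=
    { toFun := fun a => Matrix.toLin' (f a)
      map_add' := fun a b => by rw [map_add, map_add]
      map_smul' := fun c a => by
        rw [map_smul, ← algebraMap_smul K c (f a), map_smul] }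
  map_quad a b c d := by
    simp [hf, tetrad, Matrix.toLin'_mul, Module.End.mul_eq_comp, LinearMap.comp_assoc]

end SpecialJQS.Rep

/-! ### Classification of the irreducible representations -/

namespace systemA

open Matrix SpecialJQS

variable {F : Type*} [Field F] {K : Type*} [Field K] [Algebra F K]

/-- The two-dimensional representations of `A₂` twisted by a cube root of unity. -/
noncomputable def twistRep {w : K} (hw3 : w ^ 3 = 1) (i : Fin 6) :
    (systemA 2 F).Rep K (Fin 2 → K) :=
  Rep.ofMatrices (twist w i) (twist_quad hw3 i)

theorem twistRep_isIrreducible {w : K} (hw3 : w ^ 3 = 1) (i : Fin 6) :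
    (twistRep (F := F) hw3 i).IsIrreducible := by
  refine ⟨inferInstance, fun W hW => or_iff_not_imp_left.2 fun hbot => ?_⟩
  have h0 : w ^ (2 * (i : ℕ)) * w ^ (i : ℕ) = 1 := by
    rw [← pow_add, ← add_one_mul, pow_mul, two_add_one_eq_three, hw3, one_pow]
  -- Up to the scalar `w ^ i` and a transposition, the matrix units belong to the image of the
  -- system. They carry a vector with nonzero `j`-th coordinate to multiples of every basis vector.
  have unit (j k : Fin 2) (x) (hx : x ∈ W) : single j k (1 : K) *ᵥ x ∈ W := by
    have := W.smul_mem (w ^ (2 * (i : ℕ)))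
      (hW (ofMatrix 2 F (if Even (i : ℕ) then single j k 1 else single k j 1)) x hx)
    convert this using 1
    change _ = w ^ (2 * (i : ℕ)) • Matrix.toLin' (twist w i _) x
    rw [toLin'_apply, ← smul_mulVec]
    split_ifs with he <;> rw [twist_single, smul_smul, h0, one_smul] <;> simp [he]
  obtain ⟨x, hx, hx0⟩ := W.ne_bot_iff.1 hbot
  obtain ⟨j, hj⟩ := Function.ne_iff.1 hx0
  have basis (k : Fin 2) : Pi.single k (1 : K) ∈ W := by
    have := W.smul_mem (x j)⁻¹ (unit k j x hx)
    convert this using 1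
    replace hj : x j ≠ 0 := hj
    rw [single_mulVec, one_mul]
    ext l
    simp [Pi.single_apply, Function.update_apply, hj]
  refine Submodule.eq_top_iff'.2 fun y => ?_
  rw [pi_eq_sum_univ' y]
  exact W.sum_mem fun k _ => W.smul_mem _ (basis k)

/-- The zero representation on `K¹`. -/
noncomputable def zeroRep (F K : Type*) [Field F] [Field K] [Algebra F K] :
    (systemA 2 F).Rep K (Fin 1 → K) :=
  Rep.ofMatrices 0 (by simp [tetrad])

theorem zeroRep_isIrreducible : (zeroRep F K).IsIrreducible :=
  have : IsSimpleModule K (Fin 1 → K) := isSimpleModule_iff_finrank_eq_one.2 (by simp)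
  ⟨inferInstance, fun W _ => eq_bot_or_eq_top W⟩

/-- The dimensions of the irreducible representations. -/
abbrev irrepDim : Fin 7 → ℕ := Fin.cons 1 fun _ => 2

/-- The irreducible representations of `A₂`. -/
noncomputable def irrep (F : Type*) [Field F] {K : Type*} [Field K] [Algebra F K] {w : K}
    (hw3 : w ^ 3 = 1) : ∀ i : Fin 7, (systemA 2 F).Rep K (Fin (irrepDim i) → K) :=
  Fin.cases (zeroRep F K) (twistRep hw3)

/-- The irreducible representations of `K ⊕ 6 M₂(K)`. -/
noncomputable def modelAction (K : Type*) [Field K] :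
    ∀ i : Fin 7, Model K →ₐ[K] Module.End K (Fin (irrepDim i) → K) :=
  Fin.cases ((Algebra.ofId K _).comp (AlgHom.fst K K _))
    (fun i => (Matrix.toLinAlgEquiv' (R := K) (n := Fin 2)).toAlgHom.comp
      ((Pi.evalAlgHom K _ i).comp (AlgHom.snd K K _)))

theorem modelAction_toModel {w : K} (hw3 : w ^ 3 = 1) (i : Fin 7) (a : (systemA 2 F).Carrier) :
    modelAction K i (toModel w a) = (irrep F hw3 i).toFun a := by
  induction i using Fin.cases with
  | zero =>
    change algebraMap K _ (0 : K) = Matrix.toLin' 0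
    rw [map_zero, map_zero]
  | succ i => rfl

/-- The central primitive idempotents of `K ⊕ 6 M₂(K)`. -/
def modelIdempotent (K : Type*) [Field K] : Fin 7 → Model K :=
  Fin.cons (1, 0) fun i => (0, Pi.single i 1)

theorem sum_modelIdempotent : ∑ i, modelIdempotent K i = 1 := by
  rw [Fin.sum_univ_succ]
  refine Prod.ext (by simp [modelIdempotent, Prod.fst_sum]) (funext fun j => ?_)
  simp [modelIdempotent, Prod.snd_sum, Finset.sum_apply, Pi.single_apply]

theorem modelAction_idempotent (i j : Fin 7) :
    modelAction K i (modelIdempotent K j) = if i = j then 1 else 0 := by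
  induction i using Fin.cases with
  | zero =>
    induction j using Fin.cases with
    | zero =>
      change algebraMap K _ (1 : K) = _
      rw [map_one, if_pos rfl]
    | succ j =>
      change algebraMap K _ (0 : K) = _
      rw [map_zero, if_neg (Fin.succ_ne_zero j).symm]
  | succ i =>
    induction j using Fin.cases with
    | zero =>
      change Matrix.toLinAlgEquiv' (0 : Matrix (Fin 2) (Fin 2) K) = _
      rw [map_zero, if_neg (Fin.succ_ne_zero i)]
      rfl
    | succ j =>
      change Matrix.toLinAlgEquiv' ((Pi.single j 1 : Fin 6 → Matrix (Fin 2) (Fin 2) K) i) = _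
      rcases eq_or_ne i j with rfl | h
      · rw [Pi.single_eq_same, map_one, if_pos rfl]
        rfl
      · rw [Pi.single_eq_of_ne h, map_zero, if_neg (fun h' => h (Fin.succ_injective _ h'))]
        rfl

theorem intertwine_of_toModel [CharZero K] {w : K} (hw : w ^ 2 + w + 1 = 0) (hw3 : w ^ 3 = 1)
    {V W : Type*} [AddCommGroup V] [Module K V] [AddCommGroup W] [Module K W]
    {α : Model K →ₐ[K] Module.End K V} {β : Model K →ₐ[K] Module.End K W} (T : V →ₗ[K] W)
    (h : ∀ (a : (systemA 2 F).Carrier) (x), T (α (toModel w a) x) = β (toModel w a) (T x))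
    (b : Model K) : ∀ x, T (α b x) = β b (T x) := by
  have hb : b ∈ modelSubalgebra F w := modelSubalgebra_eq_top (F := F) hw hw3 ▸ Algebra.mem_top
  induction hb using Algebra.adjoin_induction with
  | mem b hb =>
    obtain ⟨a, rfl⟩ := hb
    exact h a
  | algebraMap r =>
    intro x
    rw [AlgHom.commutes, AlgHom.commutes, Module.algebraMap_end_apply,
      Module.algebraMap_end_apply, map_smul]
  | add x y _ _ hx hy => simp [hx, hy]
  | mul x y _ _ hx hy => simp [hx, hy]

theorem irrep_isIrreducible {w : K} (hw3 : w ^ 3 = 1) (i : Fin 7) :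
    (irrep F hw3 i).IsIrreducible := by
  induction i using Fin.cases with
  | zero => exact zeroRep_isIrreducible
  | succ i => exact twistRep_isIrreducible hw3 i

/-- The central idempotent of block `i` acts as 1 on the `i`-th representation and as 0 on every
other one. -/
theorem eq_of_irrep_iso [CharZero K] {w : K} (hw : w ^ 2 + w + 1 = 0) (hw3 : w ^ 3 = 1)
    {i j : Fin 7} (h : (irrep F hw3 i).Iso (irrep F hw3 j)) : i = j := by
  obtain ⟨e, he⟩ := h
  by_contra hij
  have key := intertwine_of_toModel (F := F) hw hw3 (α := modelAction K i) (β := modelAction K j)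
    e.toLinearMap (fun a x => by
      rw [modelAction_toModel hw3, modelAction_toModel hw3]
      exact he a x) (modelIdempotent K i)
  have := (irrep_isIrreducible (F := F) hw3 i).1
  obtain ⟨x, hx⟩ := exists_ne (0 : Fin (irrepDim i) → K)
  have := key x
  rw [modelAction_idempotent, modelAction_idempotent, if_pos rfl, if_neg (Ne.symm hij)] at this
  exact hx (e.map_eq_zero_iff.1 this)

/-- An algebra homomorphism to endomorphisms which does not kill the idempotent of a block receives
a nonzero intertwining map from the irreducible representation of that block. -/
theorem exists_intertwine_of_idempotent {V : Type*} [AddCommGroup V] [Module K V]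
    (L : Model K →ₐ[K] Module.End K V) (i : Fin 7) (hi : L (modelIdempotent K i) ≠ 0) :
    ∃ T : (Fin (irrepDim i) → K) →ₗ[K] V, T ≠ 0 ∧
      ∀ b x, T (modelAction K i b x) = L b (T x) := by
  induction i using Fin.cases with
  | zero =>
    obtain ⟨v, hv⟩ := DFunLike.ne_iff.1 hi
    change L (1, 0) v ≠ 0 at hv
    let T : (Fin 1 → K) →ₗ[K] V := (LinearMap.proj (0 : Fin 1)).smulRight (L (1, 0) v)
    refine ⟨T, fun h => ?_, fun b (x : Fin 1 → K) => ?_⟩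
    · have h1 : (1 : K) • L (1, 0) v = 0 := LinearMap.congr_fun h (fun _ => (1 : K))
      exact hv (by rwa [one_smul] at h1)
    · change (b.1 * x 0) • L (1, 0) v = L b (x 0 • L (1, 0) v)
      have hb : b * (1, 0) = b.1 • ((1, 0) : Model K) := by
        refine Prod.ext (by simp) (by simp)
      rw [map_smul, ← Module.End.mul_apply, ← map_mul, hb, map_smul, LinearMap.smul_apply,
        smul_smul, mul_comm]
  | succ i =>
    -- The block identity is `E₁₁ + E₂₂`, so one of these two survives under `L`.
    have hsum : ∑ j : Fin 2, L (0, Pi.single i (single j j 1)) ≠ 0 := by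
      convert hi
      rw [← map_sum]
      congr 1
      refine Prod.ext (by simp [modelIdempotent]) (funext fun k => ?_)
      rcases eq_or_ne k i with rfl | hk
      · simp only [Fin.sum_univ_two, modelIdempotent, Fin.cons_succ, Prod.snd_add, Pi.add_apply,
          Pi.single_eq_same]
        ext a b
        fin_cases a <;> fin_cases b <;> simp
      · simp [modelIdempotent, Pi.single_eq_of_ne hk]
    obtain ⟨j, -, hj⟩ := Finset.exists_ne_zero_of_sum_ne_zero hsum
    obtain ⟨v, hv⟩ := DFunLike.ne_iff.1 hj
    -- Column vectors are identified with the minimal left ideal of matrices supported in column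
    -- `j`, which is then applied to `v`.
    let T : (Fin 2 → K) →ₗ[K] V :=
      { toFun := fun c => L (0, Pi.single i (vecMulVec c (Pi.single j 1))) v
        map_add' := fun c d => by
          rw [← LinearMap.add_apply, ← map_add, add_vecMulVec, Pi.single_add]
          simp
        map_smul' := fun r c => by
          rw [RingHom.id_apply, ← LinearMap.smul_apply, ← map_smul, smul_vecMulVec, Pi.single_smul]
          simp }
    refine ⟨T, fun h => hv ?_, fun b (x : Fin 2 → K) => ?_⟩
    · have h1 := LinearMap.congr_fun h (Pi.single j 1)
      change L (0, Pi.single i (vecMulVec (Pi.single j 1) (Pi.single j 1))) v = 0 at h1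
      rwa [← single_eq_single_vecMulVec_single] at h1
    · change L (0, Pi.single i (vecMulVec (b.2 i *ᵥ x) (Pi.single j 1))) v =
        L b (L (0, Pi.single i (vecMulVec x (Pi.single j 1))) v)
      rw [← Module.End.mul_apply, ← map_mul, ← mul_vecMulVec]
      congr 2
      refine Prod.ext (by simp) (funext fun k => ?_)
      rcases eq_or_ne k i with rfl | hk
      · simp
      · simp [Pi.single_eq_of_ne hk]

theorem exists_iso_irrep [CharZero F] [CharZero K] {w : K} (hw : w ^ 2 + w + 1 = 0)
    (hw3 : w ^ 3 = 1) {V : Type*} [AddCommGroup V] [Module K V] (σ : (systemA 2 F).Rep K V)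
    (hσ : σ.IsIrreducible) : ∃ i : Fin 7, σ.Iso (irrep F hw3 i) := by
  obtain ⟨L, hL⟩ := σ.exists_algHom
  let Φ := AlgEquiv.ofBijective (envToModel (F := F) hw3) (envToModel_bijective hw hw3).1
  let M : Model K →ₐ[K] Module.End K V := L.comp Φ.symm.toAlgHom
  have hM (a) : M (toModel w a) = σ.toFun a := by
    rw [← hL]
    change L (Φ.symm (toModel w a)) = _
    congr 1
    rw [AlgEquiv.symm_apply_eq]
    exact (Env.baseLift_tmul_of _ _ a).symm
  have hsum : ∑ i, M (modelIdempotent K i) ≠ 0 := by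
    have := hσ.1
    rw [← map_sum, sum_modelIdempotent, map_one]
    exact one_ne_zero
  obtain ⟨i, -, hi⟩ := Finset.exists_ne_zero_of_sum_ne_zero hsum
  obtain ⟨T, hT0, hT⟩ := exists_intertwine_of_idempotent M i hi
  refine ⟨i, Rep.Iso.symm ((irrep_isIrreducible hw3 i).iso_of_ne_zero hσ T (fun a x => ?_) hT0)⟩
  rw [← hM, ← hT, modelAction_toModel hw3]

theorem irrep_zero_iso {w : K} (hw3 : w ^ 3 = 1) :
    (irrep F hw3 0).Iso (SpecialJQS.Rep.trivial (systemA 2 F) K) := by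
  refine ⟨LinearEquiv.funUnique (Fin 1) K K, fun a x => ?_⟩
  change LinearEquiv.funUnique (Fin 1) K K (Matrix.toLin' 0 x) = 0
  rw [map_zero, LinearMap.zero_apply, map_zero]

theorem irrep_one_iso {w : K} (hw3 : w ^ 3 = 1) :
    (irrep F hw3 1).Iso (systemA.natural 2 F K) := by
  refine ⟨LinearEquiv.refl K _, fun a x => ?_⟩
  change Matrix.toLin' (twist w 0 a) x = Matrix.toLin' (a.1.map (algebraMap F K)) x
  simp [twist]

end systemA

theorem fieldK_exists_cubeRoot : ∃ w : fieldK, w ^ 2 + w + 1 = 0 := by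
  let b : fieldK := ⟨_, IntermediateField.mem_adjoin_simple_self ℚ
    (1 + (Real.sqrt 3 : ℂ) * Complex.I : ℂ)⟩
  have hb : b ^ 2 - 2 * b + 4 = 0 := by
    have h3 : (Real.sqrt 3 : ℂ) ^ 2 = 3 := by
      rw [← Complex.ofReal_pow, Real.sq_sqrt (by norm_num)]
      norm_num
    apply Subtype.ext
    change (1 + (Real.sqrt 3 : ℂ) * Complex.I) ^ 2 - 2 * (1 + (Real.sqrt 3 : ℂ) * Complex.I) + 4 = 0
    linear_combination Complex.I ^ 2 * h3 + 3 * Complex.I_sq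
  -- Since `β = 1 + √-3`, this is the primitive cube root of unity `(-1 + √-3) / 2`.
  refine ⟨b / 2 - 1, ?_⟩
  linear_combination hb / 4

open systemA in
theorem proposition5p4 :
    -- the dimension of the envelope over the rationals
    Module.finrank ℚ (systemA 2 ℚ).Env = 25 ∧
    -- the structure after extension of scalars, as an isomorphism of algebras over the field `𝕂`
    Nonempty ((fieldK ⊗[ℚ] (systemA 2 ℚ).Env) ≃ₐ[fieldK]
      (fieldK × (Fin 6 → Matrix (Fin 2) (Fin 2) fieldK))) ∧
    -- a complete irredundant list of seven finite dimensional irreducible representations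
    ∃ (n : Fin 7 → ℕ) (ρ : ∀ i : Fin 7, (systemA 2 ℚ).Rep fieldK (Fin (n i) → fieldK)),
      (n 0 = 1 ∧ ∀ i : Fin 7, i ≠ 0 → n i = 2) ∧
      (ρ 0).Iso (SpecialJQS.Rep.trivial (systemA 2 ℚ) fieldK) ∧
      (ρ 1).Iso (systemA.natural 2 ℚ fieldK) ∧
      (∀ i : Fin 7, (ρ i).IsIrreducible) ∧
      (∀ i j : Fin 7, (ρ i).Iso (ρ j) → i = j) ∧
      (∀ (V : Type u) [AddCommGroup V] [Module fieldK V] [FiniteDimensional fieldK V]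
        (σ : (systemA 2 ℚ).Rep fieldK V), σ.IsIrreducible → ∃ i : Fin 7, σ.Iso (ρ i)) := by
  obtain ⟨w, hw⟩ := fieldK_exists_cubeRoot
  have hw3 : w ^ 3 = 1 := by linear_combination (w - 1) * hw
  obtain ⟨hbij, hdim⟩ := envToModel_bijective (F := ℚ) hw hw3
  refine ⟨hdim, ⟨AlgEquiv.ofBijective _ hbij⟩, irrepDim, irrep ℚ hw3, ⟨rfl, fun i hi => ?_⟩,
    irrep_zero_iso hw3, irrep_one_iso hw3, irrep_isIrreducible hw3,
    fun i j => eq_of_irrep_iso hw hw3, fun V _ _ _ σ => exists_iso_irrep hw hw3 σ⟩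
  obtain ⟨j, rfl⟩ := Fin.exists_succ_eq.2 hi
  rfl
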